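/- **Setting (homogeneous federated combinatorial bandit with a quality constraint).** There are $m$ producers and $n$ agents. All agents have the same costs $c_i\in\mathbb R$ and the same integer capacities $k_i\ge 1$ ($i\in[m]$). A procurement vector is $s=(l_1,\dots,l_m)$ with integers $0\le l_i\le k_i$. Each procured unit of producer $i$ has an independent Bernoulli$(q_i)$ quality realisation. For qualities $q$ the revenue of $s$ is $r_s=\sum_i l_i(\rho q_i-c_i)$, with $\rho>0$; $s$ satisfies the quality constraint at threshold $\theta$ if $\sum_i l_iq_i\ge\theta\sum_i l_i$. A deterministic Oracle, given qualities (or estimates of them) and a threshold, returns a procurement vector of maximal revenue (for these qualities) among those satisfying the quality constraint. Let $\alpha$ be the required threshold, $s^*$ the Oracle's choice for the true qualities and threshold $\alpha$, and $L=\max_s(r_{s^*}-r_s)$ over all procurement vectors. The regret of an agent in a round in which it procures $s$ is $r_{s^*}-r_s$ if $s$ satisfies the quality constraint (true qualities, threshold $\alpha$), and $L$ otherwise; its regret $\mathcal R_j$ is the sum over the rounds $1,\dots,T$. The qualities are *$\gamma$-separated* ($\gamma>0$) if no nonzero procurement vector has average quality $\sum_i l_iq_i/\sum_i l_i$ in $[\alpha,\alpha+\gamma)$.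 **Algorithm FCB (parameters $\gamma$, $\varepsilon>0$).** After each round every agent communicates all its observations to all the others. Let $W_i$ be the number of units procured so far from producer $i$ by all agents together, and $\hat q_i$ the mean of their realisations. In the rounds $t\le\max\{1,\tfrac{3\ln(nT)}{2n\varepsilon^2}\}$ every agent procures one unit from every producer. In every later round $t\le T$ every agent procures the vector returned by the Oracle on the estimates $\hat q_i^+=\hat q_i+\sqrt{3\ln(nt)/(2W_i)}$ with threshold $\alpha+\gamma$. **Theorem.** If the qualities are $\gamma$-separated, then the expected regret of each agent under FCB is $O(\ln(nT)/n)$. Precisely, there is a constant $C$, depending only on $m,(c_i),(k_i),(q_i),\rho,\alpha,\gamma,\varepsilon$ (not on $n$, $T$ or the choice of the Oracle), such that for all $n,T\ge 1$ and every agent $j$: $$\mathbb E[\mathcal R_j]\le C\,\frac{\ln(nT)}{n}\ \text{ if } n\le\ln(nT),\qquad \mathbb E[\mathcal R_j]\le C\ \text{ otherwise.}$$ In particular, for every $n$ the first bound holds for all sufficiently large $T$, with $C$ independent of $n$. -/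

import Mathlib

open MeasureTheory ProbabilityTheory

namespace FCB

/-- The data of the homogeneous problem with `m` producers. There is one cost vector and one
capacity vector, common to all agents. Units are indivisible, so capacities and procured
quantities are natural numbers. -/
structure Problem (m : ℕ) where
  /-- cost of one unit from producer `i`, the same for every agent -/
  cost : Fin m → ℝ
  /-- capacity of producer `i`, the same for every agent -/
  cap : Fin m → ℕ
  /-- every producer can deliver at least one unit per round -/
  one_le_cap : ∀ i, 1 ≤ cap i
  /-- quality of producer `i`: probability that a unit has realisation one -/
  quality : Fin m → ℝ
  quality_nonneg : ∀ i, 0 ≤ quality i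
  quality_le_one : ∀ i, quality i ≤ 1
  /-- proportionality constant between quality and revenue -/
  rho : ℝ
  rho_pos : 0 < rho
  /-- quality threshold -/
  alpha : ℝ

namespace Problem

variable {m : ℕ} (P : Problem m)

/-- Revenue of the procurement vector `s` if the qualities are `q`. -/
noncomputable def revenue (q : Fin m → ℝ) (s : Fin m → ℕ) : ℝ :=
  ∑ i, (s i : ℝ) * (P.rho * q i - P.cost i)

end Problem

/-- The quality constraint at threshold `θ` for qualities `q`: the average quality of the procured
units is at least `θ`, written without division. The zero vector satisfies it. -/
def MeetsQuality {m : ℕ} (q : Fin m → ℝ) (θ : ℝ) (s : Fin m → ℕ) : Prop :=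
  θ * ∑ i, (s i : ℝ) ≤ ∑ i, (s i : ℝ) * q i

namespace Problem

variable {m : ℕ} (P : Problem m)

/-- The qualities are `γ`-separated: no nonzero procurement vector within the capacities has an
average quality in the interval `[α, α + γ)`. -/
def Separated (γ : ℝ) : Prop :=
  ∀ s : Fin m → ℕ, s ≤ P.cap → s ≠ 0 →
    (∑ i, (s i : ℝ) * P.quality i) / (∑ i, (s i : ℝ)) ∉ Set.Ico P.alpha (P.alpha + γ)

/-- A deterministic exact oracle: for all (estimated) qualities `q` and all thresholds `θ` it
returns a procurement vector of maximal revenue among those within the capacities that satisfy the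
quality constraint. -/
def IsOracle (oracle : (Fin m → ℝ) → ℝ → (Fin m → ℕ)) : Prop :=
  ∀ (q : Fin m → ℝ) (θ : ℝ),
    oracle q θ ≤ P.cap ∧ MeetsQuality q θ (oracle q θ) ∧
      ∀ s : Fin m → ℕ, s ≤ P.cap → MeetsQuality q θ s →
        P.revenue q s ≤ P.revenue q (oracle q θ)

/-- `L`: the largest value of `r_{s*} - r_s` over all procurement vectors `s`, where `s*` is the
choice of the oracle when the mean qualities are known. -/
noncomputable def maxRegret (oracle : (Fin m → ℝ) → ℝ → (Fin m → ℕ)) : ℝ :=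
  (Finset.Icc (0 : Fin m → ℕ) P.cap).sup' ⟨0, by simp⟩ fun s =>
    P.revenue P.quality (oracle P.quality P.alpha) - P.revenue P.quality s

open Classical in
/-- Regret of one agent in a round in which it procures `s`. -/
noncomputable def roundRegret (oracle : (Fin m → ℝ) → ℝ → (Fin m → ℕ)) (s : Fin m → ℕ) : ℝ :=
  if MeetsQuality P.quality P.alpha s then
    P.revenue P.quality (oracle P.quality P.alpha) - P.revenue P.quality s
  else P.maxRegret oracle

/-- `X j i w` is the quality realisation of the `w`-th unit (counted from `0` over all rounds) that
agent `j` procures from producer `i`. All the realisations are independent, and those of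
producer `i` are Bernoulli with parameter `P.quality i`. -/
structure IsRealisation {n : ℕ} {Ω : Type*} [MeasurableSpace Ω] (μ : Measure Ω)
    (X : Fin n → Fin m → ℕ → Ω → Bool) : Prop where
  measurable : ∀ j i w, Measurable (X j i w)
  prob_true : ∀ j i w, μ.real {ω | X j i w ω = true} = P.quality i
  indep : iIndepFun (fun p : Fin n × Fin m × ℕ => X p.1 p.2.1 p.2.2) μ

end Problem

/-- What one agent keeps track of. -/
structure AgentState (m : ℕ) where
  /-- units of each producer procured by this agent so far -/
  own : Fin m → ℕ
  /-- units of each producer that this agent knows to be procured by all agents together -/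
  total : Fin m → ℕ
  /-- number of units among these with quality realisation one -/
  good : Fin m → ℕ

/-- The state before the first round. -/
def AgentState.init (m : ℕ) : AgentState m := ⟨0, 0, 0⟩

/-- Upper confidence bound of the quality of producer `i` computed by an agent in state `st` in
round `t`, with `n` agents: empirical mean of all shared observations plus confidence radius. -/
noncomputable def ucb {m : ℕ} (n t : ℕ) (st : AgentState m) (i : Fin m) : ℝ :=
  (st.good i : ℝ) / (st.total i : ℝ)
    + Real.sqrt (3 * Real.log ((n : ℝ) * t) / (2 * (st.total i : ℝ)))

open Classical in
/-- Procurement vector that an agent in state `st` picks in round `t ∈ {1, …, T}`. The algorithm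
explores while `t ≤ 3 ln(nT) / (2 n ε²)`, and always in the first round; afterwards it
calls the oracle on the upper confidence bounds with threshold `α + γ`. -/
noncomputable def pick {m : ℕ} (P : Problem m) (oracle : (Fin m → ℝ) → ℝ → (Fin m → ℕ))
    (γ ε : ℝ) (n T t : ℕ) (st : AgentState m) : Fin m → ℕ :=
  if (t : ℝ) ≤ max 1 (3 * Real.log ((n : ℝ) * T) / (2 * n * ε ^ 2)) then fun _ => 1
  else oracle (ucb n t st) (P.alpha + γ)

/-- States of the agents after `t` rounds, for the realisations `x`. In each round every agent picks
a procurement vector, observes the realisations of the procured units and communicates them to all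
other agents; every agent updates its state with the observations of all agents. -/
noncomputable def states {m n : ℕ} (P : Problem m) (oracle : (Fin m → ℝ) → ℝ → (Fin m → ℕ))
    (γ ε : ℝ) (T : ℕ) (x : Fin n → Fin m → ℕ → Bool) : ℕ → Fin n → AgentState m
  | 0 => fun _ => AgentState.init m
  | t + 1 =>
    let st := states P oracle γ ε T x t
    let s : Fin n → Fin m → ℕ := fun j => pick P oracle γ ε n T (t + 1) (st j)
    fun j =>
      { own := fun i => (st j).own i + s j i
        total := fun i => (st j).total i + ∑ j', s j' i
        good := fun i => (st j).good i +
          ∑ j', ∑ w ∈ Finset.range (s j' i), (x j' i ((st j').own i + w)).toNat }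

/-- Total regret of agent `j` over the rounds `1, …, T`, for the realisations `x`. -/
noncomputable def regret {m n : ℕ} (P : Problem m) (oracle : (Fin m → ℝ) → ℝ → (Fin m → ℕ))
    (γ ε : ℝ) (T : ℕ) (x : Fin n → Fin m → ℕ → Bool) (j : Fin n) : ℝ :=
  ∑ t ∈ Finset.range T,
    P.roundRegret oracle (pick P oracle γ ε n T (t + 1) (states P oracle γ ε T x t j))

end FCB

namespace FCB

variable {m n : ℕ}

/-- Number of realisations equal to one among the first `w i` units that every agent procures from
producer `i`. -/
def successes (x : Fin n → Fin m → ℕ → Bool) (w : Fin m → ℕ) (i : Fin m) : ℕ :=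
  ∑ j, ∑ u ∈ Finset.range (w i), (x j i u).toNat

/-- The common state of all agents once each of them has procured `w i` units from producer `i`. -/
def sharedState (x : Fin n → Fin m → ℕ → Bool) (w : Fin m → ℕ) : AgentState m :=
  ⟨w, fun i => n * w i, successes x w⟩

/-- Units procured by each single agent during the first `t` rounds. -/
noncomputable def counts (P : Problem m) (oracle : (Fin m → ℝ) → ℝ → (Fin m → ℕ))
    (γ ε : ℝ) (T : ℕ) (x : Fin n → Fin m → ℕ → Bool) : ℕ → Fin m → ℕ
  | 0 => 0
  | t + 1 => counts P oracle γ ε T x t +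
      pick P oracle γ ε n T (t + 1) (sharedState x (counts P oracle γ ε T x t))

/-- The procurement vector of every agent in round `t + 1`. -/
noncomputable def procured (P : Problem m) (oracle : (Fin m → ℝ) → ℝ → (Fin m → ℕ))
    (γ ε : ℝ) (T : ℕ) (x : Fin n → Fin m → ℕ → Bool) (t : ℕ) : Fin m → ℕ :=
  pick P oracle γ ε n T (t + 1) (sharedState x (counts P oracle γ ε T x t))

lemma counts_succ (P : Problem m) (oracle : (Fin m → ℝ) → ℝ → (Fin m → ℕ))
    (γ ε : ℝ) (T : ℕ) (x : Fin n → Fin m → ℕ → Bool) (t : ℕ) (i : Fin m) :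
    counts P oracle γ ε T x (t + 1) i =
      counts P oracle γ ε T x t i + procured P oracle γ ε T x t i := rfl

lemma successes_add (x : Fin n → Fin m → ℕ → Bool) (w s : Fin m → ℕ) (i : Fin m) :
    successes x (w + s) i = successes x w i +
      ∑ j, ∑ u ∈ Finset.range (s i), (x j i (w i + u)).toNat := by
  simp only [successes, Pi.add_apply, Finset.sum_range_add, Finset.sum_add_distrib]

lemma states_eq_sharedState (P : Problem m) (oracle : (Fin m → ℝ) → ℝ → (Fin m → ℕ))
    (γ ε : ℝ) (T : ℕ) (x : Fin n → Fin m → ℕ → Bool) (t : ℕ) (j : Fin n) :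
    states P oracle γ ε T x t j = sharedState x (counts P oracle γ ε T x t) := by
  induction t generalizing j with
  | zero =>
    simp only [states, AgentState.init, sharedState, counts]
    congr 1
    ext i
    simp [successes]
  | succ t ih =>
    simp only [states, ih, sharedState, counts]
    congr 1
    · ext i
      simp [mul_add]
    · ext i
      exact (successes_add x _ _ i).symm

lemma regret_eq_sum (P : Problem m) (oracle : (Fin m → ℝ) → ℝ → (Fin m → ℕ))
    (γ ε : ℝ) (T : ℕ) (x : Fin n → Fin m → ℕ → Bool) (j : Fin n) :
    regret P oracle γ ε T x j =
      ∑ t ∈ Finset.range T, P.roundRegret oracle (procured P oracle γ ε T x t) := by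
  simp only [regret, states_eq_sharedState, procured]

lemma pick_le_cap {P : Problem m} {oracle : (Fin m → ℝ) → ℝ → (Fin m → ℕ)}
    (ho : P.IsOracle oracle) (γ ε : ℝ) (n T t : ℕ) (st : AgentState m) :
    pick P oracle γ ε n T t st ≤ P.cap := by
  unfold pick
  split_ifs
  · exact fun i => P.one_le_cap i
  · exact (ho _ _).1

lemma counts_le {P : Problem m} {oracle : (Fin m → ℝ) → ℝ → (Fin m → ℕ)}
    (ho : P.IsOracle oracle) (γ ε : ℝ) (T : ℕ) (x : Fin n → Fin m → ℕ → Bool) (t : ℕ)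
    (i : Fin m) : counts P oracle γ ε T x t i ≤ t * P.cap i := by
  induction t with
  | zero => simp [counts]
  | succ t ih =>
    have := pick_le_cap ho γ ε n T (t + 1) (sharedState x (counts P oracle γ ε T x t)) i
    rw [counts_succ, add_mul, one_mul]
    exact add_le_add ih this

lemma counts_mono (P : Problem m) (oracle : (Fin m → ℝ) → ℝ → (Fin m → ℕ))
    (γ ε : ℝ) (T : ℕ) (x : Fin n → Fin m → ℕ → Bool) (i : Fin m) :
    Monotone fun t => counts P oracle γ ε T x t i :=
  monotone_nat_of_le_succ fun t => by rw [counts_succ]; exact Nat.le_add_right _ _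

lemma one_le_counts (P : Problem m) (oracle : (Fin m → ℝ) → ℝ → (Fin m → ℕ))
    (γ ε : ℝ) (T : ℕ) (x : Fin n → Fin m → ℕ → Bool) {t : ℕ} (ht : 1 ≤ t) (i : Fin m) :
    1 ≤ counts P oracle γ ε T x t i := by
  refine le_trans ?_ (counts_mono P oracle γ ε T x i ht)
  simp [counts, pick]

namespace Problem

variable (P : Problem m)

/-- A bound for the absolute revenue of all procurement vectors within the capacities. -/
noncomputable def revenueBound : ℝ := ∑ i, (P.cap i : ℝ) * |P.rho * P.quality i - P.cost i|

lemma revenueBound_nonneg : 0 ≤ P.revenueBound :=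
  Finset.sum_nonneg fun _ _ => by positivity

lemma abs_revenue_le {s : Fin m → ℕ} (hs : s ≤ P.cap) :
    |P.revenue P.quality s| ≤ P.revenueBound := by
  refine (Finset.abs_sum_le_sum_abs _ _).trans (Finset.sum_le_sum fun i _ => ?_)
  rw [abs_mul, Nat.abs_cast]
  have : (s i : ℝ) ≤ P.cap i := by exact_mod_cast hs i
  gcongr

lemma maxRegret_le {oracle : (Fin m → ℝ) → ℝ → (Fin m → ℕ)} (ho : P.IsOracle oracle) :
    P.maxRegret oracle ≤ 2 * P.revenueBound := by
  refine Finset.sup'_le _ _ fun s hs => ?_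
  have h1 := abs_le.1 (P.abs_revenue_le (Finset.mem_Icc.1 hs).2)
  have h2 := abs_le.1 (P.abs_revenue_le (ho P.quality P.alpha).1)
  linarith

lemma maxRegret_nonneg {oracle : (Fin m → ℝ) → ℝ → (Fin m → ℕ)} (ho : P.IsOracle oracle) :
    0 ≤ P.maxRegret oracle := by
  have h : oracle P.quality P.alpha ∈ Finset.Icc (0 : Fin m → ℕ) P.cap :=
    Finset.mem_Icc.2 ⟨fun _ => Nat.zero_le _, (ho P.quality P.alpha).1⟩
  have := Finset.le_sup' (fun s =>
    P.revenue P.quality (oracle P.quality P.alpha) - P.revenue P.quality s) h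
  simpa [maxRegret] using this

lemma roundRegret_nonneg {oracle : (Fin m → ℝ) → ℝ → (Fin m → ℕ)} (ho : P.IsOracle oracle)
    {s : Fin m → ℕ} (hs : s ≤ P.cap) : 0 ≤ P.roundRegret oracle s := by
  unfold roundRegret
  split_ifs with h
  · exact sub_nonneg.2 ((ho P.quality P.alpha).2.2 s hs h)
  · exact P.maxRegret_nonneg ho

lemma roundRegret_le {oracle : (Fin m → ℝ) → ℝ → (Fin m → ℕ)} (ho : P.IsOracle oracle)
    {s : Fin m → ℕ} (hs : s ≤ P.cap) : P.roundRegret oracle s ≤ 2 * P.revenueBound := by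
  unfold roundRegret
  split_ifs with h
  · have h1 := abs_le.1 (P.abs_revenue_le hs)
    have h2 := abs_le.1 (P.abs_revenue_le (ho P.quality P.alpha).1)
    linarith
  · exact P.maxRegret_le ho

/-- Distinct revenues of procurement vectors within the capacities differ by at least some positive
gap. -/
lemma exists_revenue_gap :
    ∃ Δ : ℝ, 0 < Δ ∧ ∀ s s' : Fin m → ℕ, s ≤ P.cap → s' ≤ P.cap →
      P.revenue P.quality s < P.revenue P.quality s' →
        Δ ≤ P.revenue P.quality s' - P.revenue P.quality s := by
  classical
  let A := Finset.Icc (0 : Fin m → ℕ) P.cap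
  let D := (((A ×ˢ A).image fun p => P.revenue P.quality p.2 - P.revenue P.quality p.1).filter
    (0 < ·))
  rcases D.eq_empty_or_nonempty with h | h
  · refine ⟨1, one_pos, fun s s' hs hs' hlt => ?_⟩
    have : P.revenue P.quality s' - P.revenue P.quality s ∈ D :=
      Finset.mem_filter.2 ⟨Finset.mem_image.2 ⟨(s, s'), by simp [A, hs, hs'], rfl⟩, by linarith⟩
    simp [h] at this
  · refine ⟨D.min' h, (Finset.mem_filter.1 (D.min'_mem h)).2, fun s s' hs hs' hlt => ?_⟩
    exact D.min'_le _
      (Finset.mem_filter.2 ⟨Finset.mem_image.2 ⟨(s, s'), by simp [A, hs, hs'], rfl⟩, by linarith⟩)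

variable {P} in
lemma Separated.meetsQuality_add {γ : ℝ} (hsep : P.Separated γ) {s : Fin m → ℕ}
    (hs : s ≤ P.cap) (h : MeetsQuality P.quality P.alpha s) :
    MeetsQuality P.quality (P.alpha + γ) s := by
  rcases eq_or_ne s 0 with rfl | h0
  · simp [MeetsQuality]
  obtain ⟨i, hi⟩ := Function.ne_iff.1 h0
  have hpos : 0 < ∑ i, (s i : ℝ) :=
    Finset.sum_pos' (fun _ _ => by positivity)
      ⟨i, Finset.mem_univ _, by exact_mod_cast Nat.pos_of_ne_zero hi⟩
  have := hsep s hs h0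
  rw [Set.mem_Ico, not_and, not_lt] at this
  exact (le_div_iff₀ hpos).1 (this ((le_div_iff₀ hpos).2 h))

/-- If the oracle is called on optimistic estimates with threshold `α + γ` and its choice has
positive regret, then it uses a producer whose quality is overestimated substantially. -/
lemma exists_overestimated {γ : ℝ} (hγ : 0 < γ) (hsep : P.Separated γ) :
    ∃ δ : ℝ, 0 < δ ∧ ∀ oracle : (Fin m → ℝ) → ℝ → (Fin m → ℕ), P.IsOracle oracle →
      ∀ q : Fin m → ℝ, (∀ i, P.quality i ≤ q i) →
        P.roundRegret oracle (oracle q (P.alpha + γ)) ≠ 0 →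
          ∃ i, 1 ≤ oracle q (P.alpha + γ) i ∧ δ ≤ q i - P.quality i := by
  obtain ⟨Δ, hΔ, hgap⟩ := P.exists_revenue_gap
  have hK : (0 : ℝ) < ∑ i, (P.cap i : ℝ) + 1 := by positivity
  have hρ := P.rho_pos
  refine ⟨min γ (Δ / (P.rho * (∑ i, (P.cap i : ℝ) + 1))), by positivity,
    fun oracle ho q hq hne => ?_⟩
  obtain ⟨hcap, hmeet, hmax⟩ := ho q (P.alpha + γ)
  set s := oracle q (P.alpha + γ) with hs
  by_contra! hcon
  have hlt : ∀ d : ℝ, min γ (Δ / (P.rho * (∑ i, (P.cap i : ℝ) + 1))) ≤ d →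
      ∑ i, (s i : ℝ) * (q i - P.quality i) ≤ d * ∑ i, (s i : ℝ) := by
    intro d hd
    rw [Finset.mul_sum]
    refine Finset.sum_le_sum fun i _ => ?_
    rcases Nat.eq_zero_or_pos (s i) with h0 | h1
    · simp [h0]
    · rw [mul_comm]
      exact mul_le_mul_of_nonneg_right ((hcon i h1).le.trans hd) (by positivity)
  have hdiff : ∑ i, (s i : ℝ) * (q i - P.quality i) =
      ∑ i, (s i : ℝ) * q i - ∑ i, (s i : ℝ) * P.quality i := by
    simp only [mul_sub, Finset.sum_sub_distrib]
  have htrue : MeetsQuality P.quality P.alpha s := by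
    have := hlt γ (min_le_left _ _)
    unfold MeetsQuality at hmeet ⊢
    rw [hdiff] at this
    linarith
  obtain ⟨hcap', hmeet', hmax'⟩ := ho P.quality P.alpha
  set s' := oracle P.quality P.alpha with hs'
  rw [roundRegret, if_pos htrue, ← hs'] at hne
  have hpos : P.revenue P.quality s < P.revenue P.quality s' :=
    lt_of_le_of_ne (hmax' s hcap htrue) fun h => hne (by rw [h, sub_self])
  have hΔle := hgap s s' hcap hcap' hpos
  have hfeas : MeetsQuality q (P.alpha + γ) s' :=
    (hsep.meetsQuality_add hcap' hmeet').trans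
      (Finset.sum_le_sum fun i _ => mul_le_mul_of_nonneg_left (hq i) (by positivity))
  have h1 := hmax s' hcap' hfeas
  have h2 : P.revenue P.quality s' ≤ P.revenue q s' := by
    refine Finset.sum_le_sum fun i _ => ?_
    have := hq i
    gcongr
  have h3 : P.revenue q s - P.revenue P.quality s =
      P.rho * ∑ i, (s i : ℝ) * (q i - P.quality i) := by
    rw [revenue, revenue, ← Finset.sum_sub_distrib, Finset.mul_sum]
    exact Finset.sum_congr rfl fun i _ => by ring
  have h4 := hlt _ (min_le_right _ _)
  have h5 : ∑ i, (s i : ℝ) < ∑ i, (P.cap i : ℝ) + 1 := by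
    have : ∑ i, (s i : ℝ) ≤ ∑ i, (P.cap i : ℝ) :=
      Finset.sum_le_sum fun i _ => by exact_mod_cast hcap i
    linarith
  have h6 : P.rho * ∑ i, (s i : ℝ) * (q i - P.quality i) < Δ := by
    calc P.rho * ∑ i, (s i : ℝ) * (q i - P.quality i)
        ≤ P.rho * (Δ / (P.rho * (∑ i, (P.cap i : ℝ) + 1)) * ∑ i, (s i : ℝ)) := by gcongr
      _ < P.rho * (Δ / (P.rho * (∑ i, (P.cap i : ℝ) + 1)) * (∑ i, (P.cap i : ℝ) + 1)) := by
        gcongr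
      _ = Δ := by field_simp
  linarith

end Problem

/-- Some empirical mean that may be in use in round `t + 1` is off by the confidence radius. -/
def Misestimated (P : Problem m) (t : ℕ) (x : Fin n → Fin m → ℕ → Bool) : Prop :=
  ∃ i, ∃ w ∈ Finset.Icc 1 (t * P.cap i),
    (n * w : ℝ) * √(3 * Real.log (n * (t + 1)) / (2 * (n * w))) ≤
      |(successes x (fun _ => w) i : ℝ) - n * w * P.quality i|

lemma ucb_mem_of_not_misestimated {P : Problem m} {oracle : (Fin m → ℝ) → ℝ → (Fin m → ℕ)}
    (ho : P.IsOracle oracle) (γ ε : ℝ) (T : ℕ) (x : Fin n → Fin m → ℕ → Bool) (hn : 1 ≤ n)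
    {t : ℕ} (ht : 1 ≤ t) (hx : ¬ Misestimated P t x) (i : Fin m) :
    P.quality i ≤ ucb n (t + 1) (sharedState x (counts P oracle γ ε T x t)) i ∧
      ucb n (t + 1) (sharedState x (counts P oracle γ ε T x t)) i ≤ P.quality i +
        2 * √(3 * Real.log (n * (t + 1)) / (2 * (n * counts P oracle γ ε T x t i))) := by
  set c := counts P oracle γ ε T x t with hc
  have hc1 : 1 ≤ c i := one_le_counts P oracle γ ε T x ht i
  have hlt : |(successes x c i : ℝ) - n * c i * P.quality i| <
      (n * c i : ℝ) * √(3 * Real.log (n * (t + 1)) / (2 * (n * c i))) := by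
    by_contra! h
    exact hx ⟨i, c i, Finset.mem_Icc.2 ⟨hc1, counts_le ho γ ε T x t i⟩, h⟩
  have hpos : (0 : ℝ) < n * c i := by
    have : (1 : ℝ) ≤ n := by exact_mod_cast hn
    have : (1 : ℝ) ≤ c i := by exact_mod_cast hc1
    positivity
  have heq : ucb n (t + 1) (sharedState x c) i = (successes x c i : ℝ) / (n * c i) +
      √(3 * Real.log (n * (t + 1)) / (2 * (n * c i))) := by
    simp [ucb, sharedState]
  have hmean : |(successes x c i : ℝ) / (n * c i) - P.quality i| <
      √(3 * Real.log (n * (t + 1)) / (2 * (n * c i))) := by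
    have : (successes x c i : ℝ) / (n * c i) - P.quality i =
        ((successes x c i : ℝ) - n * c i * P.quality i) / (n * c i) := by
      field_simp
    rw [this, abs_div, abs_of_pos hpos, div_lt_iff₀' hpos]
    exact hlt
  obtain ⟨h1, h2⟩ := abs_lt.1 hmean
  rw [heq]
  constructor <;> linarith

open Classical in
/-- A quantity that grows whenever it is used is used only boundedly often while it is small. -/
lemma sum_indicator_le_of_growth (c : ℕ → ℕ) (s : ℕ → ℕ) (hc : ∀ t, c (t + 1) = c t + s t)
    {M : ℝ} (hM : 0 ≤ M) (T : ℕ) :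
    ∑ t ∈ Finset.range T, (if 1 ≤ s t ∧ (c t : ℝ) ≤ M then (1 : ℝ) else 0) ≤ M + 1 := by
  rw [← Finset.sum_filter, Finset.sum_const, nsmul_eq_mul, mul_one]
  have hmono : Monotone c := monotone_nat_of_le_succ fun t => by rw [hc]; exact Nat.le_add_right _ _
  have hstep : ∀ a b : ℕ, 1 ≤ s a → a < b → c a < c b := fun a b ha hab =>
    lt_of_lt_of_le (by rw [hc]; omega) (hmono (Nat.succ_le_of_lt hab))
  have hcard : ((Finset.range T).filter fun t => 1 ≤ s t ∧ (c t : ℝ) ≤ M).card ≤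
      (Finset.range (⌊M⌋₊ + 1)).card := by
    refine Finset.card_le_card_of_injOn c (fun t ht => ?_) fun a ha b hb hab => ?_
    · have := (Finset.mem_filter.1 ht).2.2
      simpa [Nat.lt_succ_iff] using Nat.le_floor this
    · have ha' := (Finset.mem_filter.1 ha).2.1
      have hb' := (Finset.mem_filter.1 hb).2.1
      rcases lt_trichotomy a b with h | h | h
      · exact absurd hab (hstep a b ha' h).ne
      · exact h
      · exact absurd hab.symm (hstep b a hb' h).ne
  calc (((Finset.range T).filter fun t => 1 ≤ s t ∧ (c t : ℝ) ≤ M).card : ℝ)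
      ≤ (⌊M⌋₊ : ℝ) + 1 := by exact_mod_cast hcard.trans (by simp)
    _ ≤ M + 1 := by gcongr; exact Nat.floor_le hM

open Classical in
lemma sum_indicator_succ_le {τ : ℝ} (hτ : 0 ≤ τ) (T : ℕ) :
    ∑ t ∈ Finset.range T, (if ((t + 1 : ℕ) : ℝ) ≤ τ then (1 : ℝ) else 0) ≤ τ := by
  rw [← Finset.sum_filter, Finset.sum_const, nsmul_eq_mul, mul_one]
  have hcard : ((Finset.range T).filter fun t => ((t + 1 : ℕ) : ℝ) ≤ τ).card ≤
      (Finset.range ⌊τ⌋₊).card := by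
    refine Finset.card_le_card fun t ht => ?_
    have := (Finset.mem_filter.1 ht).2
    exact Finset.mem_range.2 (Nat.le_floor this)
  calc (((Finset.range T).filter fun t => ((t + 1 : ℕ) : ℝ) ≤ τ).card : ℝ)
      ≤ (⌊τ⌋₊ : ℝ) := by exact_mod_cast hcard.trans (by simp)
    _ ≤ τ := Nat.floor_le hτ

lemma le_of_le_two_mul_sqrt {δ ℓ a : ℝ} (hδ : 0 < δ) (ha : 0 < a)
    (h : δ ≤ 2 * √(3 * ℓ / (2 * a))) : a ≤ 6 * ℓ / δ ^ 2 := by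
  have hs : δ / 2 ≤ √(3 * ℓ / (2 * a)) := by linarith
  have := (Real.le_sqrt' (by positivity)).1 hs
  rw [le_div_iff₀ (by positivity)] at this
  rw [le_div_iff₀ (by positivity)]
  linarith

open Classical in
/-- Pathwise regret bound: exploration rounds, rounds that use a producer with few observations,
and rounds with a failing confidence interval. -/
lemma regret_le {P : Problem m} {oracle : (Fin m → ℝ) → ℝ → (Fin m → ℕ)}
    (ho : P.IsOracle oracle) {γ ε δ : ℝ} (hδ : 0 < δ)
    (hover : ∀ q : Fin m → ℝ, (∀ i, P.quality i ≤ q i) →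
        P.roundRegret oracle (oracle q (P.alpha + γ)) ≠ 0 →
          ∃ i, 1 ≤ oracle q (P.alpha + γ) i ∧ δ ≤ q i - P.quality i)
    {T : ℕ} (hn : 1 ≤ n) (hT : 1 ≤ T) (x : Fin n → Fin m → ℕ → Bool) (j : Fin n) :
    regret P oracle γ ε T x j ≤ 2 * P.revenueBound *
      (max 1 (3 * Real.log ((n : ℝ) * T) / (2 * n * ε ^ 2)) +
        m * (6 * Real.log ((n : ℝ) * T) / (n * δ ^ 2) + 1) +
        ∑ t ∈ Finset.range T, if Misestimated P t x then 1 else 0) := by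
  set τ := max 1 (3 * Real.log ((n : ℝ) * T) / (2 * n * ε ^ 2)) with hτ
  set M := 6 * Real.log ((n : ℝ) * T) / (n * δ ^ 2) with hM
  have hn' : (1 : ℝ) ≤ n := by exact_mod_cast hn
  have hT' : (1 : ℝ) ≤ T := by exact_mod_cast hT
  have hB := P.revenueBound_nonneg
  have hM0 : 0 ≤ M := by
    have : 0 ≤ Real.log ((n : ℝ) * T) := Real.log_nonneg (by nlinarith)
    positivity
  have hround : ∀ t ∈ Finset.range T, P.roundRegret oracle (procured P oracle γ ε T x t) ≤
      2 * P.revenueBound * ((if ((t + 1 : ℕ) : ℝ) ≤ τ then (1 : ℝ) else 0) +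
        (∑ i, if 1 ≤ procured P oracle γ ε T x t i ∧ (counts P oracle γ ε T x t i : ℝ) ≤ M
          then (1 : ℝ) else 0) + if Misestimated P t x then 1 else 0) := by
    intro t htT
    have hle := P.roundRegret_le ho (pick_le_cap ho γ ε n T (t + 1)
      (sharedState x (counts P oracle γ ε T x t)))
    change P.roundRegret oracle (procured P oracle γ ε T x t) ≤ _ at hle
    have h1 : (0 : ℝ) ≤ if ((t + 1 : ℕ) : ℝ) ≤ τ then (1 : ℝ) else 0 := by split_ifs <;> norm_num
    have h2 : ∀ i, (0 : ℝ) ≤ if 1 ≤ procured P oracle γ ε T x t i ∧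
        (counts P oracle γ ε T x t i : ℝ) ≤ M then (1 : ℝ) else 0 := fun i => by
      split_ifs <;> norm_num
    have h2' := Finset.sum_nonneg fun i (_ : i ∈ Finset.univ) => h2 i
    have h3 : (0 : ℝ) ≤ if Misestimated P t x then (1 : ℝ) else 0 := by split_ifs <;> norm_num
    by_cases hzero : P.roundRegret oracle (procured P oracle γ ε T x t) = 0
    · rw [hzero]
      positivity
    refine hle.trans (le_mul_of_one_le_right (by positivity) ?_)
    by_cases hexp : ((t + 1 : ℕ) : ℝ) ≤ τ
    · rw [if_pos hexp] at h1 ⊢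
      linarith
    by_cases hmis : Misestimated P t x
    · rw [if_pos hmis] at h3 ⊢
      linarith
    have ht1 : 1 ≤ t := by
      by_contra! h0
      obtain rfl : t = 0 := by omega
      exact hexp (by simp [hτ])
    have hproc : procured P oracle γ ε T x t =
        oracle (ucb n (t + 1) (sharedState x (counts P oracle γ ε T x t))) (P.alpha + γ) :=
      if_neg hexp
    have hucb := ucb_mem_of_not_misestimated ho γ ε T x hn ht1 hmis
    rw [hproc] at hzero
    obtain ⟨i, hi1, hi2⟩ := hover _ (fun i => (hucb i).1) hzero
    rw [← hproc] at hi1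
    have hc1 : (1 : ℝ) ≤ counts P oracle γ ε T x t i := by
      exact_mod_cast one_le_counts P oracle γ ε T x ht1 i
    have hsmall : (counts P oracle γ ε T x t i : ℝ) ≤ M := by
      have h5 : (n * counts P oracle γ ε T x t i : ℝ) ≤ 6 * Real.log (n * (t + 1)) / δ ^ 2 :=
        le_of_le_two_mul_sqrt hδ (by positivity) (by linarith [(hucb i).2])
      have h6 : Real.log (n * (t + 1)) ≤ Real.log (n * T) := by
        have : ((t + 1 : ℕ) : ℝ) ≤ T := by exact_mod_cast Finset.mem_range.1 htT
        push_cast at this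
        gcongr
      rw [hM, mul_comm (n : ℝ) (δ ^ 2), ← div_div, le_div_iff₀ (by positivity), mul_comm]
      refine h5.trans ?_
      gcongr
    have h7 := Finset.single_le_sum (fun i _ => h2 i) (Finset.mem_univ i)
    rw [if_pos ⟨hi1, hsmall⟩] at h7
    linarith
  rw [regret_eq_sum]
  refine (Finset.sum_le_sum hround).trans ?_
  rw [← Finset.mul_sum, Finset.sum_add_distrib, Finset.sum_add_distrib, Finset.sum_comm]
  have hA := sum_indicator_succ_le (τ := τ) (by positivity) T
  have hC : ∑ i : Fin m, ∑ t ∈ Finset.range T,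
      (if 1 ≤ procured P oracle γ ε T x t i ∧ (counts P oracle γ ε T x t i : ℝ) ≤ M
        then (1 : ℝ) else 0) ≤ m * (M + 1) := by
    calc _ ≤ ∑ _i : Fin m, (M + 1) := Finset.sum_le_sum fun i _ =>
          sum_indicator_le_of_growth (fun t => counts P oracle γ ε T x t i)
            (fun t => procured P oracle γ ε T x t i)
            (fun t => counts_succ P oracle γ ε T x t i) hM0 T
      _ = m * (M + 1) := by simp [mul_add]
  gcongr

variable {Ω : Type*} [MeasurableSpace Ω] {μ : Measure Ω}
  {X : Fin n → Fin m → ℕ → Ω → Bool}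

lemma measurable_successes (hX : ∀ j i w, Measurable (X j i w)) (w : Fin m → ℕ) (i : Fin m) :
    Measurable fun ω => successes (fun j i w => X j i w ω) w i := by
  unfold successes
  exact Finset.measurable_sum _ fun j _ => Finset.measurable_sum _ fun u _ =>
    (measurable_of_countable Bool.toNat).comp (hX j i _)

lemma measurable_counts (hX : ∀ j i w, Measurable (X j i w)) (P : Problem m)
    (oracle : (Fin m → ℝ) → ℝ → (Fin m → ℕ)) (γ ε : ℝ) (T t : ℕ) :
    Measurable fun ω => counts P oracle γ ε T (fun j i w => X j i w ω) t := by
  induction t with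
  | zero => exact measurable_const
  | succ t ih =>
    have hS : Measurable fun p : Ω × (Fin m → ℕ) =>
        successes (fun j i w => X j i w p.1) p.2 :=
      measurable_from_prod_countable_left fun w =>
        measurable_pi_lambda _ fun i => measurable_successes hX w i
    have hS' := hS.comp (measurable_id.prodMk ih)
    let G : (Fin m → ℕ) × (Fin m → ℕ) → Fin m → ℕ := fun p =>
      p.1 + pick P oracle γ ε n T (t + 1) ⟨p.1, fun i => n * p.1 i, p.2⟩
    exact (measurable_of_countable G).comp (ih.prodMk hS')

lemma measurable_procured (hX : ∀ j i w, Measurable (X j i w)) (P : Problem m)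
    (oracle : (Fin m → ℝ) → ℝ → (Fin m → ℕ)) (γ ε : ℝ) (T t : ℕ) :
    Measurable fun ω => procured P oracle γ ε T (fun j i w => X j i w ω) t := by
  let G : (Fin m → ℕ) × (Fin m → ℕ) → Fin m → ℕ := fun p => p.2 - p.1
  have h := (measurable_of_countable G).comp
    ((measurable_counts hX P oracle γ ε T t).prodMk (measurable_counts hX P oracle γ ε T (t + 1)))
  convert h using 1
  ext ω i
  simp [G, counts_succ]

lemma measurable_regret (hX : ∀ j i w, Measurable (X j i w)) (P : Problem m)
    (oracle : (Fin m → ℝ) → ℝ → (Fin m → ℕ)) (γ ε : ℝ) (T : ℕ) (j : Fin n) :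
    Measurable fun ω => regret P oracle γ ε T (fun j i w => X j i w ω) j := by
  simp only [regret_eq_sum]
  exact Finset.measurable_sum _ fun t _ => (measurable_of_countable (P.roundRegret oracle)).comp
    (measurable_procured hX P oracle γ ε T t)

lemma integrable_regret [IsFiniteMeasure μ] (hX : ∀ j i w, Measurable (X j i w)) {P : Problem m}
    {oracle : (Fin m → ℝ) → ℝ → (Fin m → ℕ)} (ho : P.IsOracle oracle) (γ ε : ℝ) (T : ℕ)
    (j : Fin n) :
    Integrable (fun ω => regret P oracle γ ε T (fun j i w => X j i w ω) j) μ := by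
  refine Integrable.of_bound (measurable_regret hX P oracle γ ε T j).aestronglyMeasurable
    (T * (2 * P.revenueBound)) (.of_forall fun ω => ?_)
  rw [regret_eq_sum, Real.norm_eq_abs]
  refine (Finset.abs_sum_le_sum_abs _ _).trans ?_
  refine (Finset.sum_le_card_nsmul _ _ (2 * P.revenueBound) fun t _ => ?_).trans_eq (by simp)
  have hs := pick_le_cap ho γ ε n T (t + 1)
    (sharedState (fun j i w => X j i w ω) (counts P oracle γ ε T (fun j i w => X j i w ω) t))
  rw [procured, abs_of_nonneg (P.roundRegret_nonneg ho hs)]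
  exact P.roundRegret_le ho hs

/-- Two-sided **Hoeffding inequality** for the number of successes of one producer. -/
lemma measureReal_successes_deviation_le [IsProbabilityMeasure μ] {P : Problem m}
    (hX : P.IsRealisation μ X) (i : Fin m) (w : ℕ) {r : ℝ} (hr : 0 ≤ r) :
    μ.real {ω | r ≤ |(successes (fun j i w => X j i w ω) (fun _ => w) i : ℝ) -
      n * w * P.quality i|} ≤ 2 * Real.exp (-2 * r ^ 2 / (n * w)) := by
  let Y : Fin n × ℕ → Ω → ℝ := fun p ω => ((X p.1 i p.2 ω).toNat : ℝ) - P.quality i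
  let A : Finset (Fin n × ℕ) := Finset.univ ×ˢ Finset.range w
  have hind : iIndepFun Y μ := by
    have h := hX.indep.precomp (g := fun p : Fin n × ℕ => (p.1, i, p.2)) (fun p p' h => by
      simpa [Prod.ext_iff] using h)
    exact h.comp (fun _ b => ((b.toNat : ℝ) - P.quality i)) fun _ => measurable_of_countable _
  have hsub : ∀ p, HasSubgaussianMGF (Y p) (1 / 4) μ := by
    intro p
    have hm : Measurable fun ω => ((X p.1 i p.2 ω).toNat : ℝ) :=
      (measurable_of_countable fun b : Bool => (b.toNat : ℝ)).comp (hX.measurable _ _ _)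
    have h := hasSubgaussianMGF_of_mem_Icc (μ := μ) (a := 0) (b := 1) hm.aemeasurable
      (.of_forall fun ω => by cases X p.1 i p.2 ω <;> simp)
    have hmean : ∫ ω, ((X p.1 i p.2 ω).toNat : ℝ) ∂μ = P.quality i := by
      have hset : MeasurableSet {ω | X p.1 i p.2 ω = true} :=
        hX.measurable p.1 i p.2 (measurableSet_singleton true)
      rw [← hX.prob_true p.1 i p.2, ← integral_indicator_one hset]
      refine integral_congr_ae (.of_forall fun ω => ?_)
      cases hb : X p.1 i p.2 ω <;> simp [Set.indicator, hb]
    rw [hmean] at h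
    convert h using 1
    norm_num
  have hsum : ∀ ω, ∑ p ∈ A, Y p ω =
      (successes (fun j i w => X j i w ω) (fun _ => w) i : ℝ) - n * w * P.quality i := by
    intro ω
    simp only [A, Y, successes, Finset.sum_product, Finset.sum_sub_distrib]
    simp
    ring
  have hc : ((∑ _p ∈ A, (1 / 4 : NNReal) : NNReal) : ℝ) = n * w / 4 := by
    simp [A]
    ring
  have hexp : Real.exp (-r ^ 2 / (2 * ((∑ _p ∈ A, (1 / 4 : NNReal) : NNReal) : ℝ))) =
      Real.exp (-2 * r ^ 2 / (n * w)) := by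
    rw [hc]
    congr 1
    rw [show 2 * ((n : ℝ) * w / 4) = n * w / 2 by ring, div_div_eq_mul_div]
    ring
  have hup := HasSubgaussianMGF.measure_sum_ge_le_of_iIndepFun hind (s := A)
    (fun p _ => hsub p) hr
  have hneg : iIndepFun (fun p => -Y p) μ := hind.comp (fun _ y => -y) fun _ => measurable_neg
  have hdown := HasSubgaussianMGF.measure_sum_ge_le_of_iIndepFun hneg (s := A)
    (fun p _ => (hsub p).neg) hr
  rw [hexp] at hup hdown
  have hset : {ω | r ≤ |(successes (fun j i w => X j i w ω) (fun _ => w) i : ℝ) -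
      n * w * P.quality i|} ⊆ {ω | r ≤ ∑ p ∈ A, Y p ω} ∪ {ω | r ≤ ∑ p ∈ A, (-Y p) ω} := by
    intro ω hω
    simp only [Set.mem_ofPred_eq, Set.mem_union, Pi.neg_apply, Finset.sum_neg_distrib, hsum] at hω ⊢
    exact le_abs.1 hω
  calc _ ≤ _ := measureReal_mono hset
    _ ≤ _ := measureReal_union_le _ _
    _ ≤ _ := by linarith

lemma measurableSet_misestimated (hX : ∀ j i w, Measurable (X j i w)) (P : Problem m) (t : ℕ) :
    MeasurableSet {ω | Misestimated P t fun j i w => X j i w ω} := by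
  simp only [Misestimated, Set.ofPred_exists, Set.ofPred_and]
  refine .iUnion fun i => .iUnion fun w => .inter (.const _) ?_
  have := measurable_successes hX (fun _ => w) i
  refine measurableSet_le measurable_const ?_
  fun_prop

lemma measureReal_misestimated_le [IsProbabilityMeasure μ] {P : Problem m}
    (hX : P.IsRealisation μ X) (hn : 1 ≤ n) (t : ℕ) :
    μ.real {ω | Misestimated P t fun j i w => X j i w ω} ≤
      2 * (∑ i, (P.cap i : ℝ)) * (1 / (t + 1) - 1 / (t + 2)) := by
  have hn' : (1 : ℝ) ≤ n := by exact_mod_cast hn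
  have ht0 : (0 : ℝ) ≤ t := by positivity
  have hone : ∀ i, ∀ w ∈ Finset.Icc 1 (t * P.cap i),
      μ.real {ω | (n * w : ℝ) * √(3 * Real.log (n * (t + 1)) / (2 * (n * w))) ≤
        |(successes (fun j i w => X j i w ω) (fun _ => w) i : ℝ) - n * w * P.quality i|} ≤
        2 / (t + 1) ^ 3 := by
    intro i w hw
    have hw' : (1 : ℝ) ≤ w := by exact_mod_cast (Finset.mem_Icc.1 hw).1
    have hnt : (1 : ℝ) ≤ n * (t + 1) := by nlinarith
    have hlog : 0 ≤ Real.log (n * (t + 1)) := Real.log_nonneg hnt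
    refine (measureReal_successes_deviation_le hX i w (by positivity)).trans ?_
    have hexp : -2 * ((n * w : ℝ) * √(3 * Real.log (n * (t + 1)) / (2 * (n * w)))) ^ 2 / (n * w) =
        -(Real.log ((n * (t + 1)) ^ 3)) := by
      rw [mul_pow, Real.sq_sqrt (by positivity), Real.log_pow]
      field_simp
      norm_num [mul_comm]
    rw [hexp, Real.exp_neg, Real.exp_log (by positivity), div_eq_mul_inv]
    gcongr
    nlinarith
  have hset : {ω | Misestimated P t fun j i w => X j i w ω} ⊆
      ⋃ i ∈ (Finset.univ : Finset (Fin m)), ⋃ w ∈ Finset.Icc 1 (t * P.cap i),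
        {ω | (n * w : ℝ) * √(3 * Real.log (n * (t + 1)) / (2 * (n * w))) ≤
          |(successes (fun j i w => X j i w ω) (fun _ => w) i : ℝ) - n * w * P.quality i|} := by
    rintro ω ⟨i, w, hw, h⟩
    simp only [Set.mem_iUnion]
    exact ⟨i, Finset.mem_univ _, w, hw, h⟩
  calc _ ≤ _ := measureReal_mono hset (measure_ne_top _ _)
    _ ≤ ∑ i, ∑ w ∈ Finset.Icc 1 (t * P.cap i), (2 / (t + 1) ^ 3 : ℝ) :=
      (measureReal_biUnion_finset_le _ _).trans (Finset.sum_le_sum fun i _ =>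
        (measureReal_biUnion_finset_le _ _).trans (Finset.sum_le_sum (hone i)))
    _ = 2 * (∑ i, (P.cap i : ℝ)) * (t / (t + 1) ^ 3) := by
      simp only [Finset.sum_const, Nat.card_Icc, add_tsub_cancel_right, nsmul_eq_mul,
        Finset.mul_sum, Finset.sum_mul]
      refine Finset.sum_congr rfl fun i _ => ?_
      push_cast
      ring
    _ ≤ 2 * (∑ i, (P.cap i : ℝ)) * (1 / (t + 1) - 1 / (t + 2)) := by
      gcongr
      rw [div_sub_div _ _ (by positivity) (by positivity),
        div_le_div_iff₀ (by positivity) (by positivity)]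
      nlinarith [pow_nonneg ht0 2]

lemma sum_measureReal_misestimated_le [IsProbabilityMeasure μ] {P : Problem m}
    (hX : P.IsRealisation μ X) (hn : 1 ≤ n) (T : ℕ) :
    ∑ t ∈ Finset.range T, μ.real {ω | Misestimated P t fun j i w => X j i w ω} ≤
      2 * ∑ i, (P.cap i : ℝ) := by
  refine (Finset.sum_le_sum fun t _ => measureReal_misestimated_le hX hn t).trans ?_
  rw [← Finset.mul_sum]
  have htel : ∑ t ∈ Finset.range T, ((1 : ℝ) / (t + 1) - 1 / (t + 2)) = 1 - 1 / (T + 1) := by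
    have := Finset.sum_range_sub' (fun t : ℕ => (1 : ℝ) / (t + 1)) T
    simp only [Nat.cast_add, Nat.cast_one, add_assoc, one_add_one_eq_two] at this
    simpa using this
  rw [htel]
  refine mul_le_of_le_one_right (by positivity) ?_
  have : (0 : ℝ) ≤ 1 / (T + 1) := by positivity
  linarith

open Classical in
/-- Expected regret bound with explicit exploration and estimation terms. -/
lemma integral_regret_le [IsProbabilityMeasure μ] {P : Problem m}
    {oracle : (Fin m → ℝ) → ℝ → (Fin m → ℕ)} (ho : P.IsOracle oracle) {γ ε δ : ℝ} (hδ : 0 < δ)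
    (hover : ∀ q : Fin m → ℝ, (∀ i, P.quality i ≤ q i) →
        P.roundRegret oracle (oracle q (P.alpha + γ)) ≠ 0 →
          ∃ i, 1 ≤ oracle q (P.alpha + γ) i ∧ δ ≤ q i - P.quality i)
    {T : ℕ} (hn : 1 ≤ n) (hT : 1 ≤ T) (hX : P.IsRealisation μ X) (j : Fin n) :
    ∫ ω, regret P oracle γ ε T (fun j i w => X j i w ω) j ∂μ ≤ 2 * P.revenueBound *
      (max 1 (3 * Real.log ((n : ℝ) * T) / (2 * n * ε ^ 2)) +
        m * (6 * Real.log ((n : ℝ) * T) / (n * δ ^ 2) + 1) + 2 * ∑ i, (P.cap i : ℝ)) := by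
  have hB := P.revenueBound_nonneg
  have hmeas := fun t => measurableSet_misestimated hX.measurable P t
  have hint : ∀ t ∈ Finset.range T, Integrable
      (fun ω => if Misestimated P t (fun j i w => X j i w ω) then (1 : ℝ) else 0) μ :=
    fun t _ => (integrable_const (1 : ℝ)).indicator (hmeas t)
  have hval : ∀ t, ∫ ω, (if Misestimated P t (fun j i w => X j i w ω) then (1 : ℝ) else 0) ∂μ =
      μ.real {ω | Misestimated P t fun j i w => X j i w ω} :=
    fun t => integral_indicator_one (hmeas t)
  have hle := integral_mono (integrable_regret hX.measurable ho γ ε T j)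
    (((integrable_const _).add (integrable_finsetSum _ hint)).const_mul (2 * P.revenueBound))
    (fun ω => regret_le ho (ε := ε) hδ hover hn hT (fun j i w => X j i w ω) j)
  refine hle.trans ?_
  simp only [Pi.add_apply]
  rw [integral_const_mul, integral_add (integrable_const _) (integrable_finsetSum _ hint),
    integral_finsetSum _ hint, integral_const, probReal_univ, one_smul]
  simp only [hval]
  have := sum_measureReal_misestimated_le hX hn T
  gcongr

end FCB

theorem theorem1 {m : ℕ} (P : FCB.Problem m) (γ ε : ℝ) (hγ : 0 < γ) (hε : 0 < ε)
    (hsep : P.Separated γ) :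
    ∃ C : ℝ, 0 < C ∧
      ∀ (oracle : (Fin m → ℝ) → ℝ → (Fin m → ℕ)), P.IsOracle oracle →
      ∀ (n T : ℕ), 1 ≤ n → 1 ≤ T →
      ∀ (Ω : Type*) [MeasurableSpace Ω] (μ : Measure Ω) [IsProbabilityMeasure μ]
        (X : Fin n → Fin m → ℕ → Ω → Bool), P.IsRealisation μ X →
      ∀ j : Fin n,
        Integrable (fun ω => FCB.regret P oracle γ ε T (fun j i w => X j i w ω) j) μ ∧
        ((n : ℝ) ≤ Real.log ((n : ℝ) * T) →
          ∫ ω, FCB.regret P oracle γ ε T (fun j i w => X j i w ω) j ∂μ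
            ≤ C * (Real.log ((n : ℝ) * T) / n)) ∧
        (Real.log ((n : ℝ) * T) < (n : ℝ) →
          ∫ ω, FCB.regret P oracle γ ε T (fun j i w => X j i w ω) j ∂μ ≤ C) := by
  obtain ⟨δ, hδ, hover⟩ := P.exists_overestimated hγ hsep
  have hB := P.revenueBound_nonneg
  have hK : 0 ≤ ∑ i, (P.cap i : ℝ) := by positivity
  set B := P.revenueBound
  set K := ∑ i, (P.cap i : ℝ)
  let a := 1 + m + 2 * K
  let b := 3 / (2 * ε ^ 2) + m * (6 / δ ^ 2)
  have ha : 0 ≤ a := by positivity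
  have hb : 0 ≤ b := by positivity
  refine ⟨2 * B * (a + b) + 1, by positivity,
    fun oracle ho n T hn hT Ω _ μ _ X hX j => ?_⟩
  have hn' : (0 : ℝ) < n := by exact_mod_cast hn
  have hnT : (1 : ℝ) ≤ n * T := by exact_mod_cast Nat.mul_pos hn hT
  have hlog := Real.log_nonneg hnT
  have hbound : ∫ ω, FCB.regret P oracle γ ε T (fun j i w => X j i w ω) j ∂μ ≤
      2 * B * (a + b * (Real.log ((n : ℝ) * T) / n)) := by
    refine (FCB.integral_regret_le ho hδ (hover oracle ho) hn hT hX j).trans ?_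
    have hmax : max 1 (3 * Real.log ((n : ℝ) * T) / (2 * n * ε ^ 2)) ≤
        1 + 3 / (2 * ε ^ 2) * (Real.log ((n : ℝ) * T) / n) := by
      have h0 : 0 ≤ 3 / (2 * ε ^ 2) * (Real.log ((n : ℝ) * T) / n) := by positivity
      refine max_le (by linarith) ?_
      have : 3 * Real.log ((n : ℝ) * T) / (2 * n * ε ^ 2) =
          3 / (2 * ε ^ 2) * (Real.log ((n : ℝ) * T) / n) := by
        field_simp
      linarith
    have hfew : 6 * Real.log ((n : ℝ) * T) / (n * δ ^ 2) =
        6 / δ ^ 2 * (Real.log ((n : ℝ) * T) / n) := by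
      field_simp
    rw [hfew]
    refine mul_le_mul_of_nonneg_left ?_ (by positivity)
    simp only [a, b]
    linarith
  refine ⟨FCB.integrable_regret hX.measurable ho γ ε T j, fun h => ?_, fun h => ?_⟩
  · have h1 : 1 ≤ Real.log ((n : ℝ) * T) / n := (one_le_div hn').2 h
    refine hbound.trans ?_
    set ℓ := Real.log ((n : ℝ) * T) / n
    have : a + b * ℓ ≤ (a + b) * ℓ := by nlinarith
    calc 2 * B * (a + b * ℓ) ≤ 2 * B * ((a + b) * ℓ) := by gcongr
      _ ≤ (2 * B * (a + b) + 1) * ℓ := by linarith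
  · have h1 : Real.log ((n : ℝ) * T) / n ≤ 1 := ((div_lt_one hn').2 h).le
    refine hbound.trans ?_
    have : a + b * (Real.log ((n : ℝ) * T) / n) ≤ a + b := by nlinarith
    calc 2 * B * (a + b * (Real.log ((n : ℝ) * T) / n)) ≤ 2 * B * (a + b) := by gcongr
      _ ≤ _ := by linarith
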